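/- Consider randomized query algorithms that access a finite simple graph $G=(V,E)$ only through (1) random vertex queries, each returning an independent uniformly random vertex of $V$, (2) random edge queries, each returning an independent uniformly random edge of $E$, and (3) degree queries, which return $\deg(v)$ for a vertex $v\in V$ that was returned by an earlier random vertex query or as an endpoint by an earlier random edge query. The algorithm may choose its queries adaptively and at random. It does not know $V$, $n=|V|$ or $m=|E|$ in advance, and vertices are presented to it under arbitrary distinct names. Theorem. There are an absolute constant $C>0$ and, for each $0<\varepsilon<1$, such an algorithm $A_\varepsilon$ with the following property. For every finite graph $G$ with $n$ vertices and $m\ge 1$ edges, whatever the names of its vertices, $A_\varepsilon$ stops and returns, with probability at least $2/3$, a number $\hat d$ with $(1-\varepsilon)d\le\hat d\le(1+\varepsilon)d$, where $d=2m/n$ is the average degree; and the expected number of queries that $A_\varepsilon$ makes (queries of all three kinds are counted) is at most $$C\left(\frac{m\,\log\log d}{n'\,\varepsilon^{2}}+\frac{n}{n'\,\varepsilon^{2}}\right),$$ where $n'$ is the number of non-isolated vertices of $G$ (those of nonzero degree) and $\log\log d$ is read as $0$ when $d\le e$. -/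

import Mathlib

open scoped ENNReal

universe u

namespace EdgeCount

/-- The three kinds of queries. Vertices are known to an algorithm only through their names,
which are natural numbers. -/
inductive Query : Type
  | randomVertex : Query
  | randomEdge : Query
  | degree (x : ℕ) : Query

/-- A query together with its answer, as an algorithm sees it: the name of a sampled vertex, the
unordered pair of the names of the endpoints of a sampled edge, or the degree `k` of the vertex
with name `x`. -/
inductive Event : Type
  | vertex (x : ℕ) : Event
  | edge (e : Sym2 ℕ) : Event
  | degree (x k : ℕ) : Event

/-- The names of the vertices returned by a sampling query. -/
def Event.revealed : Event → Set ℕ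
  | .vertex x => {x}
  | .edge e => {x | x ∈ e}
  | .degree _ _ => ∅

/-- The queries made so far and their answers, the most recent one first. -/
abbrev Transcript : Type := List Event

/-- The names that the sampling queries of a transcript have returned. -/
def Transcript.seen (h : Transcript) : Set ℕ := {x | ∃ e ∈ h, x ∈ e.revealed}

/-- An adaptive randomized query algorithm. Given everything seen so far, it chooses at random
either the next query (`Sum.inl`) or to stop with a real number as its output (`Sum.inr`). It knows
nothing about the graph except for the transcript, and it asks for the degree of a vertex only
if that vertex was returned by an earlier sampling query. -/
structure Algorithm : Type where
  next : Transcript → PMF (Query ⊕ ℝ)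
  legal : ∀ (h : Transcript) (x : ℕ), Sum.inl (Query.degree x) ∈ (next h).support → x ∈ h.seen

/-- The state of an execution: the transcript, and the output once the algorithm has stopped. -/
abbrev State : Type := Transcript × Option ℝ

section Execution

variable {V : Type u} [Fintype V] [DecidableEq V] [Nonempty V]
  (G : SimpleGraph V) [DecidableRel G.Adj] (name : V ↪ ℕ) (hE : G.edgeFinset.Nonempty)

open Classical in
/-- The degree of the vertex with name `x` (the value `0` at a number that names no vertex is
never used, since algorithms query the degrees of returned vertices only). -/
noncomputable def degreeOfName (x : ℕ) : ℕ :=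
  if hx : ∃ v, name v = x then G.degree hx.choose else 0

/-- The random answer to a query: a uniformly random vertex, a uniformly random edge, or the degree
of the given vertex. -/
noncomputable def answer : Query → PMF Event
  | .randomVertex => (PMF.uniformOfFintype V).map fun v => Event.vertex (name v)
  | .randomEdge => (PMF.uniformOfFinset G.edgeFinset hE).map fun e => Event.edge (e.map name)
  | .degree x => PMF.pure (Event.degree x (degreeOfName G name x))

/-- One step of an execution. -/
noncomputable def step (A : Algorithm) : State → PMF State
  | (h, some r) => PMF.pure (h, some r)
  | (h, none) => (A.next h).bind fun a =>
      match a with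
      | Sum.inl q => (answer G name hE q).map fun e => (e :: h, none)
      | Sum.inr r => PMF.pure (h, some r)

/-- The law of the state after `t` steps. -/
noncomputable def run (A : Algorithm) : ℕ → PMF State
  | 0 => PMF.pure ([], none)
  | t + 1 => (run A t).bind (step G name hE A)

/-- The expected total number of queries, of all three kinds: the limit of the expected number
of queries made within the first `t` steps, which is nondecreasing in `t`. -/
noncomputable def expectedQueries (A : Algorithm) : ℝ≥0∞ :=
  ⨆ t : ℕ, ∑' s : State, run G name hE A t s * (s.1.length : ℝ≥0∞)

/-- The probability that the algorithm stops with an output in `S`: the limit of the probability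
that it does so within the first `t` steps, which is nondecreasing in `t`. -/
noncomputable def outputProb (A : Algorithm) (S : Set ℝ) : ℝ≥0∞ :=
  ⨆ t : ℕ, (run G name hE A t).toOuterMeasure {s : State | ∃ r ∈ S, s.2 = some r}

end Execution

section Parameters

variable {V : Type u} [Fintype V] [DecidableEq V] (G : SimpleGraph V) [DecidableRel G.Adj]

/-- The average degree `2m/n`. -/
noncomputable def avgDegree : ℝ := 2 * (G.edgeFinset.card : ℝ) / (Fintype.card V : ℝ)

/-- The number of vertices of nonzero degree. -/
def numNonIsolated : ℕ := (Finset.univ.filter fun v : V => G.degree v ≠ 0).card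

end Parameters

/-- The set of `(1 ± ε)`-approximations of `x`. -/
def approximations (ε x : ℝ) : Set ℝ := {y | (1 - ε) * x ≤ y ∧ y ≤ (1 + ε) * x}

/-- The iterated logarithm `log log x`, read as `0` for `x ≤ e`, where it would be
negative or undefined. -/
noncomputable def logLog (x : ℝ) : ℝ := Real.log (max 1 (Real.log (max 1 x)))

end EdgeCount

open scoped BigOperators

namespace EdgeCount

/-! The mean of the reciprocal endpoint degrees of a random edge has expectation `n'/(2m)`, and the
indicator that a random vertex is non-isolated has expectation `n'/n`; the quotient of the second by
the first is `d`. Neither expectation is known in advance, so both kinds of values are summed until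
they reach a threshold `K` of order `1/ε²`. For values in `[0, 1]` with mean `μ`, the number of
samples this takes concentrates around `K/μ` (`iter_not_typical_le`), so the ratio of the two counts
approximates `d`. By Wald's identity each expected count is at most `(K+1)/μ`
(`iter_hitting_mul_le`).

The expected number of queries is thus `O((m+n)/(n'ε²))`. The iterated logarithm is slack: it is at
least `1` once `d` exceeds a constant, and otherwise `m = O(n)` (`le_logLog_add`). Executions reduce
to lists of independent samples through `run_eq`. -/

/-- A normalized positive linear functional on the real functions on `Ω`. -/
structure Mean (Ω : Type*) where
  toLinear : (Ω → ℝ) →ₗ[ℝ] ℝ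
  nonneg : ∀ f : Ω → ℝ, (∀ ω, 0 ≤ f ω) → 0 ≤ toLinear f
  const_one : toLinear (fun _ => 1) = 1

/-! ### Independent samples and Chebyshev's inequality -/

namespace Mean

variable {Ω : Type*} (M : Mean Ω)

instance : CoeFun (Mean Ω) fun _ => (Ω → ℝ) → ℝ := ⟨fun M => M.toLinear⟩

theorem map_add (f g : Ω → ℝ) : M (fun ω => f ω + g ω) = M f + M g :=
  M.toLinear.map_add f g

theorem map_sub (f g : Ω → ℝ) : M (fun ω => f ω - g ω) = M f - M g :=
  M.toLinear.map_sub f g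

theorem map_const_mul (c : ℝ) (f : Ω → ℝ) : M (fun ω => c * f ω) = c * M f :=
  M.toLinear.map_smul c f

theorem map_const (c : ℝ) : M (fun _ => c) = c := by
  have h := M.map_const_mul c (fun _ => 1)
  simpa [M.const_one] using h

theorem mono {f g : Ω → ℝ} (h : ∀ ω, f ω ≤ g ω) : M f ≤ M g := by
  have := M.nonneg (fun ω => g ω - f ω) fun ω => sub_nonneg.2 (h ω)
  rw [M.map_sub] at this
  linarith

/-- The mean over the lists of `T` independent samples, the last sample first. -/
noncomputable def iter : ℕ → Mean (List Ω)
  | 0 =>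
    { toLinear := LinearMap.proj []
      nonneg := fun _ hf => hf []
      const_one := rfl }
  | T + 1 =>
    { toLinear := (iter T).toLinear ∘ₗ
        LinearMap.pi fun L => M.toLinear ∘ₗ LinearMap.funLeft ℝ ℝ fun ω => ω :: L
      nonneg := fun f hf => (iter T).nonneg _ fun L => M.nonneg _ fun ω => hf (ω :: L)
      const_one := by
        change (iter T) (fun L => M fun ω => 1) = 1
        simp only [M.map_const]
        exact (iter T).const_one }

theorem iter_zero (f : List Ω → ℝ) : M.iter 0 f = f [] := rfl

theorem iter_succ (T : ℕ) (f : List Ω → ℝ) :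
    M.iter (T + 1) f = M.iter T fun L => M fun ω => f (ω :: L) := rfl

/-- Dropping from the front discards the latest samples, so events about different initial segments
can be compared under one law. -/
theorem iter_drop (T j : ℕ) (f : List Ω → ℝ) :
    M.iter (T + j) (fun L => f (L.drop j)) = M.iter T f := by
  induction j with
  | zero => rfl
  | succ j ih =>
    rw [← add_assoc, iter_succ]
    simpa [M.map_const] using ih

theorem iter_mono_of_length (T : ℕ) {f g : List Ω → ℝ}
    (h : ∀ L : List Ω, L.length = T → f L ≤ g L) : M.iter T f ≤ M.iter T g := by
  induction T generalizing f g with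
  | zero => exact h [] rfl
  | succ T ih =>
    rw [iter_succ, iter_succ]
    exact ih fun L hL => M.mono fun ω => h _ (by simp [hL])

variable {X : Ω → ℝ}

/-- Variances of independent samples add, and `X² ≤ X` on `[0, 1]` bounds each by the mean. A bound
proportional to `M X` is what keeps small means affordable. -/
theorem iter_sq_deviation_le (h0 : ∀ ω, 0 ≤ X ω) (h1 : ∀ ω, X ω ≤ 1) (T : ℕ) :
    M.iter T (fun L => ((L.map X).sum - T * M X) ^ 2) ≤ T * M X := by
  induction T with
  | zero => simp [iter_zero]
  | succ T ih =>
    rw [iter_succ]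
    have hsq : M (fun ω => X ω ^ 2) ≤ M X :=
      M.mono fun ω => by nlinarith [h0 ω, h1 ω]
    have key : ∀ L : List Ω,
        M (fun ω => (((ω :: L).map X).sum - ((T + 1 : ℕ) : ℝ) * M X) ^ 2) ≤
          ((L.map X).sum - T * M X) ^ 2 + M X := by
      intro L
      set a := (L.map X).sum - T * M X with ha
      have : (fun ω => (((ω :: L).map X).sum - ((T + 1 : ℕ) : ℝ) * M X) ^ 2) =
          fun ω => (X ω ^ 2 + (2 * (a - M X)) * X ω) + (a - M X) ^ 2 := by
        funext ω
        simp only [List.map_cons, List.sum_cons, ha]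
        push_cast
        ring
      rw [this, M.map_add, M.map_add, M.map_const_mul, M.map_const]
      nlinarith [sq_nonneg (M X)]
    calc _ ≤ M.iter T (fun L => ((L.map X).sum - T * M X) ^ 2 + M X) := (M.iter T).mono key
      _ ≤ _ := by
        rw [(M.iter T).map_add, (M.iter T).map_const]
        push_cast
        linarith

open Classical in
/-- Chebyshev's inequality for the sum of independent samples from `[0, 1]`. -/
theorem iter_indicator_le (h0 : ∀ ω, 0 ≤ X ω) (h1 : ∀ ω, X ω ≤ 1) (T : ℕ) {a : ℝ} (ha : 0 < a)
    {p : List Ω → Prop} (hp : ∀ L, p L → a ^ 2 ≤ ((L.map X).sum - T * M X) ^ 2) :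
    M.iter T (fun L => if p L then 1 else 0) ≤ T * M X / a ^ 2 := by
  rw [le_div_iff₀ (by positivity), mul_comm, ← (M.iter T).map_const_mul]
  refine le_trans ((M.iter T).mono fun L => ?_) (M.iter_sq_deviation_le h0 h1 T)
  split_ifs with h
  · simpa using hp L h
  · simpa using sq_nonneg _

end Mean

/-! ### Hitting counts of lists -/

/-- The number of proper suffixes of a list with sum less than `K`: for a list of nonnegative
numbers with sum at least `K`, read from its end, the number of terms at which the partial sums
reach `K`. -/
noncomputable def hitting (K : ℝ) : List ℝ → ℕ
  | [] => 0
  | _ :: xs => hitting K xs + if xs.sum < K then 1 else 0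

section Hitting

variable {K : ℝ}

theorem hitting_le_length (xs : List ℝ) : hitting K xs ≤ xs.length := by
  induction xs with
  | nil => simp [hitting]
  | cons x xs ih => simp only [hitting, List.length_cons]; split_ifs <;> omega

theorem hitting_drop_le (xs : List ℝ) (j : ℕ) : hitting K (xs.drop j) ≤ hitting K xs := by
  induction xs generalizing j with
  | nil => simp
  | cons x xs ih =>
    cases j with
    | zero => simp
    | succ j => simpa [hitting] using (ih j).trans (Nat.le_add_right _ _)

theorem hitting_eq_length {xs : List ℝ} (h0 : ∀ x ∈ xs, 0 ≤ x) (h : xs.sum < K) :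
    hitting K xs = xs.length := by
  induction xs with
  | nil => rfl
  | cons x xs ih =>
    simp only [List.mem_cons, forall_eq_or_imp, List.sum_cons] at h0 h
    have h' : xs.sum < K := by linarith [h0.1]
    simp [hitting, h', ih h0.2 h']

theorem sum_drop_le {xs : List ℝ} (h0 : ∀ x ∈ xs, 0 ≤ x) (j : ℕ) : (xs.drop j).sum ≤ xs.sum :=
  (List.drop_sublist j xs).sum_le_sum h0

theorem hitting_le_of_le_sum_drop {xs : List ℝ} (h0 : ∀ x ∈ xs, 0 ≤ x) (j : ℕ)
    (h : K ≤ (xs.drop j).sum) : hitting K xs ≤ xs.length - j := by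
  induction xs generalizing j with
  | nil => simp [hitting]
  | cons x xs ih =>
    cases j with
    | zero => simpa using hitting_le_length (K := K) (x :: xs)
    | succ j =>
      simp only [List.mem_cons, forall_eq_or_imp] at h0
      have h' : ¬ xs.sum < K := not_lt.2 (le_trans h (sum_drop_le h0.2 j))
      simpa [hitting, h'] using ih h0.2 j h

/-- By nonnegativity, all suffixes of length at most `xs.length - j` have sum below `K`. Counting
the empty one makes the inequality strict; `0 < j` makes them proper. -/
theorem lt_hitting_of_sum_drop_lt {xs : List ℝ} (h0 : ∀ x ∈ xs, 0 ≤ x) {j : ℕ}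
    (hj : j ≤ xs.length) (h0j : 0 < j) (h : (xs.drop j).sum < K) :
    xs.length - j < hitting K xs := by
  obtain ⟨j, rfl⟩ := Nat.exists_eq_add_one_of_ne_zero h0j.ne'
  have h1 := hitting_drop_le (K := K) xs j
  rw [List.drop_eq_getElem_cons (by omega)] at h1
  rw [hitting, if_pos h, hitting_eq_length (fun x hx => h0 x (List.mem_of_mem_drop hx)) h,
    List.length_drop] at h1
  omega

end Hitting

/-! ### Wald's bound and concentration of the hitting count -/

namespace Mean

variable {Ω : Type*} (M : Mean Ω) {X : Ω → ℝ}

/-- Wald's bound for the expected number of samples until their sum reaches `K`. -/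
theorem iter_hitting_mul_le (h0 : ∀ ω, 0 ≤ X ω) (h1 : ∀ ω, X ω ≤ 1) {K : ℝ}
    (hK : 0 ≤ K) (T : ℕ) : M.iter T (fun L => (hitting K (L.map X) : ℝ)) * M X ≤ K + 1 := by
  have key : ∃ Z : List Ω → ℝ, (∀ L, Z L ≤ K + 1) ∧
      ∀ T, M.iter T Z = M.iter T (fun L => (hitting K (L.map X) : ℝ)) * M X := by
    -- `Z` is the sum stopped on reaching `K`; it overshoots by at most one sample. Whether a sample
    -- counts depends only on earlier ones, so the mean of each increment factors.
    let Z : List Ω → ℝ := List.rec 0 fun ω L z => z + (if (L.map X).sum < K then 1 else 0) * X ω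
    have hZ : ∀ ω L, Z (ω :: L) = Z L + (if (L.map X).sum < K then 1 else 0) * X ω :=
      fun _ _ => rfl
    refine ⟨Z, fun L => ?_, fun T => ?_⟩
    · have : Z L ≤ K + 1 ∧ ((L.map X).sum < K → Z L = (L.map X).sum) := by
        induction L with
        | nil => exact ⟨by change (0 : ℝ) ≤ K + 1; linarith, fun _ => by simp [Z]⟩
        | cons ω L ih =>
          have hω := h0 ω
          have hω' := h1 ω
          rw [hZ, List.map_cons, List.sum_cons]
          split_ifs with h
          · rw [ih.2 h]
            exact ⟨by linarith, fun _ => by ring⟩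
          · exact ⟨by linarith [ih.1], fun _ => by linarith⟩
      exact this.1
    · induction T with
      | zero => simp [iter_zero, Z, hitting]
      | succ T ih =>
        simp only [iter_succ, hZ, List.map_cons, hitting, M.map_add, M.map_const, M.map_const_mul,
          Nat.cast_add, (M.iter T).map_add, ih, add_mul, Nat.cast_ite, Nat.cast_one, Nat.cast_zero]
        congr 1
        rw [mul_comm, ← (M.iter T).map_const_mul]
        simp only [mul_comm]
  obtain ⟨Z, hZ, h⟩ := key
  rw [← h, ← (M.iter T).map_const (K + 1)]
  exact (M.iter T).mono hZ

/-- The samples needed for a sum of at least `K` concentrate around `K / M X`. -/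
def Typical (X : Ω → ℝ) (μ δ K : ℝ) (L : List Ω) : Prop :=
  K ≤ (L.map X).sum ∧ (1 - δ) * K ≤ hitting K (L.map X) * μ ∧
    hitting K (L.map X) * μ ≤ (1 + 2 * δ) * K

-- The count exceeds `t` only if the first `t` samples sum to less than `K`, and is at most `s` only
-- if the first `s` already reach `K`. With `t` and `s` near `(1 ± δ)K/μ`, Chebyshev bounds each
-- event by `1/12`.
open Classical in
theorem iter_not_typical_le (h0 : ∀ ω, 0 ≤ X ω) (h1 : ∀ ω, X ω ≤ 1) (hμ : 0 < M X)
    {δ K : ℝ} (hδ : 0 < δ) (hδ1 : δ ≤ 1) (hK : 24 ≤ δ ^ 2 * K) {T : ℕ}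
    (hT : ⌈(1 + δ) * K / M X⌉₊ ≤ T) :
    M.iter T (fun L => if ¬ Typical X (M X) δ K L then 1 else 0) ≤ 1 / 6 := by
  set μ := M X with hμdef
  have hμ1 : μ ≤ 1 := by simpa [M.map_const] using M.mono h1
  have hδK : 24 ≤ δ * K := by nlinarith
  have hKpos : 0 < K := by nlinarith
  set t := ⌈(1 + δ) * K / μ⌉₊
  set s := ⌊(1 - δ) * K / μ⌋₊
  have ht1 : (1 + δ) * K ≤ t * μ := (div_le_iff₀ hμ).1 (Nat.le_ceil _)
  -- Rounding up costs at most `μ ≤ 1 ≤ δK`.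
  have ht2 : t * μ ≤ (1 + 2 * δ) * K := by
    have := (Nat.ceil_lt_add_one (by positivity : 0 ≤ (1 + δ) * K / μ)).le
    have := mul_le_mul_of_nonneg_right this hμ.le
    rw [add_one_mul, div_mul_cancel₀ _ hμ.ne'] at this
    linarith
  have hs1 : s * μ ≤ (1 - δ) * K :=
    (le_div_iff₀ hμ).1 (Nat.floor_le (div_nonneg (mul_nonneg (by linarith) hKpos.le) hμ.le))
  have hs2 : (1 - δ) * K ≤ (s + 1) * μ := (div_le_iff₀ hμ).1 (Nat.lt_floor_add_one _).le
  have hst : s < t := by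
    have : (s : ℝ) < t := lt_of_mul_lt_mul_right (a := μ) (by nlinarith) hμ.le
    exact_mod_cast this
  obtain ⟨j, rfl⟩ : ∃ j, T = t + j := ⟨T - t, by omega⟩
  obtain ⟨i, hi⟩ : ∃ i, t + j = s + i := ⟨t + j - s, by omega⟩
  -- At deviation `δK`, the bound `1/12` amounts to `12(1+δ)K ≤ 24K ≤ (δK)²`: this is the source of
  -- `24`.
  have hA : M.iter (t + j) (fun L => if ((L.drop j).map X).sum < K then 1 else 0) ≤ 1 / 12 := by
    rw [M.iter_drop t j fun L => if (L.map X).sum < K then 1 else 0]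
    refine (M.iter_indicator_le h0 h1 t (a := t * μ - K) (by nlinarith) fun L hL => ?_).trans ?_
    · nlinarith
    · rw [← hμdef, div_le_iff₀ (by nlinarith [mul_pos hδ hKpos])]
      nlinarith [mul_pos hδ hKpos, mul_nonneg (sub_nonneg.2 hδ1) hKpos.le,
        sq_nonneg (t * μ - K - δ * K)]
  have hB : M.iter (t + j) (fun L => if K ≤ ((L.drop i).map X).sum then 1 else 0) ≤ 1 / 12 := by
    rw [hi, M.iter_drop s i fun L => if K ≤ (L.map X).sum then 1 else 0]
    refine (M.iter_indicator_le h0 h1 s (a := K - s * μ) (by nlinarith) fun L hL => ?_).trans ?_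
    · nlinarith
    · rw [← hμdef, div_le_iff₀ (by nlinarith [mul_pos hδ hKpos])]
      nlinarith [mul_pos hδ hKpos]
  have hnn : ∀ L : List Ω, ∀ x ∈ L.map X, 0 ≤ x := by simp [h0]
  calc _ ≤ M.iter (t + j) (fun L => (if ((L.drop j).map X).sum < K then 1 else 0) +
        if K ≤ ((L.drop i).map X).sum then 1 else 0) := by
        refine M.iter_mono_of_length _ fun L hL => ?_
        by_cases hLA : ((L.drop j).map X).sum < K
        · simp only [hLA, if_true]
          split_ifs <;> norm_num
        by_cases hLB : K ≤ ((L.drop i).map X).sum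
        · simp only [hLB, if_true]
          split_ifs <;> norm_num
        have hty : Typical X μ δ K L := by
          rw [not_lt, List.map_drop] at hLA
          rw [not_le, List.map_drop] at hLB
          have hup := hitting_le_of_le_sum_drop (hnn L) j hLA
          have hlo := lt_hitting_of_sum_drop_lt (hnn L) (j := i) (by simp [hL]; omega) (by omega) hLB
          rw [List.length_map, hL] at hup hlo
          have hup' : (hitting K (L.map X) : ℝ) ≤ t := by exact_mod_cast (by omega)
          have hlo' : (s + 1 : ℝ) ≤ hitting K (L.map X) := by exact_mod_cast (by omega)
          exact ⟨hLA.trans (sum_drop_le (hnn L) j),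
            hs2.trans (mul_le_mul_of_nonneg_right hlo' hμ.le),
            (mul_le_mul_of_nonneg_right hup' hμ.le).trans ht2⟩
        simp only [hty, not_true, if_false]
        positivity
    _ ≤ 1 / 6 := by
        rw [(M.iter (t + j)).map_add]
        linarith

end Mean
-- The estimator
/-- The sample values of the rounds recorded in a transcript. A round consists of a random edge,
the degrees of its endpoints, a random vertex and its degree. Its values are the mean of the
reciprocal degrees of the endpoints of the edge, and the indicator of the event that the vertex is
not isolated. -/
noncomputable def roundValues : Transcript → List (ℝ × ℝ)
  | .degree _ j :: .vertex _ :: .degree _ l :: .degree _ k :: .edge _ :: h =>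
    (((k : ℝ)⁻¹ + (l : ℝ)⁻¹) / 2, if j = 0 then 0 else 1) :: roundValues h
  | _ => []

/-- The sums of both sample values have reached `K`. -/
def Finished (K : ℝ) (l : List (ℝ × ℝ)) : Prop :=
  K ≤ (l.map Prod.fst).sum ∧ K ≤ (l.map Prod.snd).sum

/-- The estimate of the average degree. -/
noncomputable def estimate (K : ℝ) (l : List (ℝ × ℝ)) : ℝ :=
  hitting K (l.map Prod.fst) / hitting K (l.map Prod.snd)

theorem Finished.cons {K : ℝ} {l : List (ℝ × ℝ)} (hl : Finished K l) {x : ℝ × ℝ} (h1 : 0 ≤ x.1)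
    (h2 : 0 ≤ x.2) : Finished K (x :: l) :=
  ⟨by simpa using le_add_of_nonneg_of_le h1 hl.1, by simpa using le_add_of_nonneg_of_le h2 hl.2⟩

/-- Hitting counts freeze once the sums reach `K`, so the output can be read off any longer list of
samples. -/
theorem Finished.estimate_cons {K : ℝ} {l : List (ℝ × ℝ)} (hl : Finished K l) (x : ℝ × ℝ) :
    estimate K (x :: l) = estimate K l := by
  simp [estimate, hitting, not_lt.2 hl.1, not_lt.2 hl.2]

open Classical in
/-- The move at the end of a round. -/
noncomputable def decision (K : ℝ) (h : Transcript) : Query ⊕ ℝ :=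
  if Finished K (roundValues h) then .inr (estimate K (roundValues h)) else .inl .randomEdge

/-- The next move of the estimator with threshold `K`. -/
noncomputable def nextMove (K : ℝ) : Transcript → Query ⊕ ℝ
  -- Within a round the last two events determine the position; the final case is the boundary
  -- between rounds, including the empty transcript.
  | .edge e :: _ => .inl (.degree e.inf)
  | .degree _ _ :: .edge e :: _ => .inl (.degree e.sup)
  | .degree _ _ :: .degree _ _ :: _ => .inl .randomVertex
  | .vertex x :: _ => .inl (.degree x)
  | h => decision K h

theorem sym2_inf_mem (e : Sym2 ℕ) : e.inf ∈ e := by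
  induction e with | _ a b
  rcases le_total a b with h | h <;> simp [h]

theorem sym2_sup_mem (e : Sym2 ℕ) : e.sup ∈ e := by
  induction e with | _ a b
  rcases le_total a b with h | h <;> simp [h]

theorem decision_ne_degree (K : ℝ) (h : Transcript) (x : ℕ) :
    decision K h ≠ .inl (.degree x) := by
  unfold decision
  split_ifs <;> simp

/-- The estimator with threshold `K`: it repeats rounds until the sums of both sample values have
reached `K`, and returns the ratio of the numbers of rounds that this took for the two sums. -/
noncomputable def estimator (K : ℝ) : Algorithm where
  next h := PMF.pure (nextMove K h)
  legal h x hx := by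
    simp only [PMF.support_pure, Set.mem_singleton_iff] at hx
    unfold nextMove at hx
    split at hx
    · next e h =>
      simp only [Sum.inl.injEq, Query.degree.injEq] at hx
      exact ⟨.edge e, by simp, hx ▸ sym2_inf_mem e⟩
    · next e h =>
      simp only [Sum.inl.injEq, Query.degree.injEq] at hx
      exact ⟨.edge e, by simp, hx ▸ sym2_sup_mem e⟩
    · simp at hx
    · next y h =>
      simp only [Sum.inl.injEq, Query.degree.injEq] at hx
      exact ⟨.vertex y, by simp, hx⟩
    · exact absurd hx.symm (decision_ne_degree K h x)

/-! ### Coupling executions with lists of independent samples -/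

section Simulation

variable {V : Type u} [Fintype V] (G : SimpleGraph V) [DecidableRel G.Adj] (name : V ↪ ℕ)

/-- The transcript `h`, continued by a round in which the random vertex is `ω.1` and the random edge
is `ω.2`. -/
noncomputable def roundEvents (ω : V × Sym2 V) (h : Transcript) : Transcript :=
  .degree (name ω.1) (degreeOfName G name (name ω.1)) :: .vertex (name ω.1) ::
    .degree (ω.2.map name).sup (degreeOfName G name (ω.2.map name).sup) ::
    .degree (ω.2.map name).inf (degreeOfName G name (ω.2.map name).inf) ::
    .edge (ω.2.map name) :: h

/-- The sample values of a round. -/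
noncomputable def sampleValue (ω : V × Sym2 V) : ℝ × ℝ :=
  (((degreeOfName G name (ω.2.map name).inf : ℝ)⁻¹ +
    (degreeOfName G name (ω.2.map name).sup : ℝ)⁻¹) / 2,
    if degreeOfName G name (name ω.1) = 0 then 0 else 1)

/-- The transcript of rounds with the given samples. -/
noncomputable def transcriptOf : List (V × Sym2 V) → Transcript
  | [] => []
  | ω :: L => roundEvents G name ω (transcriptOf L)

theorem roundValues_transcriptOf (L : List (V × Sym2 V)) :
    roundValues (transcriptOf G name L) = L.map (sampleValue G name) := by
  induction L with
  | nil => simp [transcriptOf, roundValues]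
  | cons ω L ih => simp [transcriptOf, roundEvents, roundValues, ih, sampleValue]

theorem nextMove_transcriptOf (K : ℝ) (L : List (V × Sym2 V)) :
    nextMove K (transcriptOf G name L) = decision K (transcriptOf G name L) := by
  cases L <;> simp [transcriptOf, roundEvents, nextMove]

open Classical in
/-- The state of the estimator after the time of one round per given sample. -/
noncomputable def simulate (K : ℝ) : List (V × Sym2 V) → State
  | [] => ([], none)
  | ω :: L =>
    match simulate K L with
    | (h, some r) => (h, some r)
    | (h, none) =>
      if Finished K (roundValues h) then (h, some (estimate K (roundValues h)))
      else (roundEvents G name ω h, none)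

theorem sampleValue_fst_nonneg (ω : V × Sym2 V) : 0 ≤ (sampleValue G name ω).1 := by
  unfold sampleValue
  positivity

theorem sampleValue_snd_nonneg (ω : V × Sym2 V) : 0 ≤ (sampleValue G name ω).2 := by
  unfold sampleValue
  split_ifs <;> simp

theorem sampleValue_fst_le_one (ω : V × Sym2 V) : (sampleValue G name ω).1 ≤ 1 := by
  have h1 := Nat.cast_inv_le_one (α := ℝ) (degreeOfName G name (ω.2.map name).inf)
  have h2 := Nat.cast_inv_le_one (α := ℝ) (degreeOfName G name (ω.2.map name).sup)
  simp only [sampleValue]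
  linarith

theorem sampleValue_snd_le_one (ω : V × Sym2 V) : (sampleValue G name ω).2 ≤ 1 := by
  simp only [sampleValue]
  split_ifs <;> simp

theorem simulate_cases (K : ℝ) (L : List (V × Sym2 V)) :
    simulate G name K L = (transcriptOf G name L, none) ∨
      Finished K (L.map (sampleValue G name)) ∧
        ∃ h, simulate G name K L = (h, some (estimate K (L.map (sampleValue G name)))) := by
  induction L with
  | nil => exact Or.inl rfl
  | cons ω L ih =>
    have hv := roundValues_transcriptOf G name L
    by_cases hf : Finished K (L.map (sampleValue G name))
    · refine Or.inr ⟨hf.cons (sampleValue_fst_nonneg G name ω)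
        (sampleValue_snd_nonneg G name ω), ?_⟩
      rw [List.map_cons, hf.estimate_cons]
      rcases ih with ih | ⟨-, h, ih⟩
      · exact ⟨_, by simp only [simulate, ih, if_pos (hv ▸ hf)]; rw [hv]⟩
      · exact ⟨h, by simp only [simulate, ih]⟩
    · rcases ih with ih | ⟨hf', -⟩
      · left
        simp only [simulate, ih, if_neg (hv ▸ hf), transcriptOf]
      · exact absurd hf' hf

theorem simulate_cons_of_finished {K : ℝ} (ω : V × Sym2 V) {L : List (V × Sym2 V)}
    (hf : Finished K (L.map (sampleValue G name))) :
    (simulate G name K (ω :: L)).2 = some (estimate K (L.map (sampleValue G name))) := by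
  rcases simulate_cases G name K L with h | ⟨-, h, h'⟩
  · have hv := roundValues_transcriptOf G name L
    simp only [simulate, h, if_pos (hv ▸ hf)]
    rw [hv]
  · simp only [simulate, h']

/-- A round is played only while one of the two sums is below `K`, so one of the two counts pays for
its five queries. -/
theorem length_simulate_le (K : ℝ) (L : List (V × Sym2 V)) :
    (simulate G name K L).1.length ≤
      5 * (hitting K (L.map fun ω => (sampleValue G name ω).1) +
        hitting K (L.map fun ω => (sampleValue G name ω).2)) := by
  induction L with
  | nil => simp [simulate]
  | cons ω L ih =>
    rcases simulate_cases G name K L with h | ⟨-, h, h'⟩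
    · have hv := roundValues_transcriptOf G name L
      by_cases hf : Finished K (L.map (sampleValue G name))
      · simp only [simulate, h, if_pos (hv ▸ hf), List.map_cons, hitting] at ih ⊢
        omega
      · simp only [simulate, h, if_neg (hv ▸ hf), List.map_cons, hitting,
          roundEvents, List.length_cons] at ih ⊢
        simp only [Finished, List.map_map, not_and_or, not_le, Function.comp_def] at hf
        rcases hf with hf | hf <;> simp only [hf, if_true] <;> omega
    · simp only [simulate, h', List.map_cons, hitting] at ih ⊢
      omega

variable [Nonempty V] (hE : G.edgeFinset.Nonempty)

/-- The law of the samples of a round. -/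
noncomputable def sample : PMF (V × Sym2 V) :=
  (PMF.uniformOfFinset G.edgeFinset hE).bind fun e => (PMF.uniformOfFintype V).map fun v => (v, e)

/-- The law of the list of `T` independent samples. -/
noncomputable def samples : ℕ → PMF (List (V × Sym2 V))
  | 0 => PMF.pure []
  | T + 1 => (samples T).bind fun L => (sample G hE).map fun ω => ω :: L

theorem step_some (A : Algorithm) (h : Transcript) (r : ℝ) :
    step G name hE A (h, some r) = PMF.pure (h, some r) := rfl

theorem step_inr {K : ℝ} {h : Transcript} {r : ℝ} (hr : nextMove K h = .inr r) :
    step G name hE (estimator K) (h, none) = PMF.pure (h, some r) := by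
  simp [step, estimator, hr]

theorem step_inl {K : ℝ} {h : Transcript} {q : Query} (hq : nextMove K h = .inl q) :
    step G name hE (estimator K) (h, none) =
      (answer G name hE q).map fun e => (e :: h, none) := by
  simp [step, estimator, hq]

theorem step_degree {K : ℝ} {h : Transcript} {x : ℕ} (hq : nextMove K h = .inl (.degree x)) :
    step G name hE (estimator K) (h, none) =
      PMF.pure (.degree x (degreeOfName G name x) :: h, none) := by
  rw [step_inl G name hE hq, answer, PMF.pure_map]

/-- Five steps play one round. If the estimator stops or has stopped, the remaining steps are idle
and the fresh sample is ignored. -/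
theorem round_eq (K : ℝ) (L : List (V × Sym2 V)) :
    ((((step G name hE (estimator K) (simulate G name K L)).bind
      (step G name hE (estimator K))).bind (step G name hE (estimator K))).bind
      (step G name hE (estimator K))).bind (step G name hE (estimator K)) =
    (sample G hE).map fun ω => simulate G name K (ω :: L) := by
  simp only [simulate]
  rcases simulate_cases G name K L with hL | ⟨-, h, hL⟩
  · rw [hL]
    by_cases hf : Finished K (roundValues (transcriptOf G name L))
    · have h1 : nextMove K (transcriptOf G name L) =
          .inr (estimate K (roundValues (transcriptOf G name L))) := by
        rw [nextMove_transcriptOf, decision, if_pos hf]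
      simp only [step_inr G name hE h1, step_some, PMF.pure_bind, if_pos hf]
      exact (PMF.map_const _ _).symm
    · have h1 : nextMove K (transcriptOf G name L) = .inl .randomEdge := by
        rw [nextMove_transcriptOf, decision, if_neg hf]
      simp only [if_neg hf, step_inl G name hE h1, answer, sample, PMF.map_bind, PMF.map_comp,
        PMF.bind_map, PMF.bind_bind]
      congr 1
      funext e
      simp only [Function.comp_apply]
      rw [step_degree G name hE (x := (e.map name).inf) rfl, PMF.pure_bind,
        step_degree G name hE (x := (e.map name).sup) rfl, PMF.pure_bind,
        step_inl G name hE (q := .randomVertex) rfl, answer, PMF.map_comp, PMF.bind_map]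
      rw [← PMF.bind_pure_comp]
      congr 1
      funext v
      exact step_degree G name hE rfl
  · simp only [hL, step_some, PMF.pure_bind]
    exact (PMF.map_const _ _).symm

theorem run_eq (K : ℝ) (T : ℕ) :
    run G name hE (estimator K) (5 * T) = (samples G hE T).map (simulate G name K) := by
  induction T with
  | zero => simp [run, samples, PMF.pure_map, simulate]
  | succ T ih =>
    change ((((((run G name hE (estimator K) (5 * T)).bind _).bind _).bind _).bind _).bind _) = _
    rw [ih, samples, PMF.map_bind]
    simp only [PMF.bind_map, PMF.bind_bind, PMF.map_comp]
    congr 1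
    funext L
    have := round_eq G name hE K L
    simp only [PMF.bind_bind] at this
    exact this

end Simulation
-- Expectations under probability mass functions
section Expectation

variable {α β : Type*}

/-- The expectation of a nonnegative function. -/
noncomputable def expectation (p : PMF α) (f : α → ℝ≥0∞) : ℝ≥0∞ := ∑' a, p a * f a

theorem expectation_bind (p : PMF α) (k : α → PMF β) (f : β → ℝ≥0∞) :
    expectation (p.bind k) f = expectation p fun a => expectation (k a) f := by
  simp only [expectation, PMF.bind_apply, ← ENNReal.tsum_mul_right, ← ENNReal.tsum_mul_left]
  rw [ENNReal.tsum_comm]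
  simp only [mul_assoc]

theorem expectation_pure (a : α) (f : α → ℝ≥0∞) : expectation (PMF.pure a) f = f a := by
  rw [expectation, tsum_eq_single a fun b hb => by simp [PMF.pure_apply, hb]]
  simp

theorem expectation_map (p : PMF α) (k : α → β) (f : β → ℝ≥0∞) :
    expectation (p.map k) f = expectation p fun a => f (k a) := by
  rw [← PMF.bind_pure_comp, expectation_bind]
  simp only [Function.comp_apply, expectation_pure]

theorem expectation_mono (p : PMF α) {f g : α → ℝ≥0∞} (h : ∀ a ∈ p.support, f a ≤ g a) :
    expectation p f ≤ expectation p g := by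
  refine ENNReal.tsum_le_tsum fun a => ?_
  by_cases ha : p a = 0
  · simp [ha]
  · exact mul_le_mul_right (h a ha) _

theorem expectation_const (p : PMF α) (c : ℝ≥0∞) : expectation p (fun _ => c) = c := by
  rw [expectation, ENNReal.tsum_mul_right, p.tsum_coe, one_mul]

open Finset in
theorem expectation_uniformOfFinset (s : Finset α) (hs : s.Nonempty) {f : α → ℝ}
    (hf : ∀ a, 0 ≤ f a) :
    expectation (PMF.uniformOfFinset s hs) (fun a => ENNReal.ofReal (f a)) =
      ENNReal.ofReal (𝔼 a ∈ s, f a) := by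
  have h0 : (0 : ℝ) < #s := by exact_mod_cast hs.card_pos
  rw [expectation, tsum_eq_sum (s := s) fun a ha => by simp [ha], expect_eq_sum_div_card,
    div_eq_inv_mul, ENNReal.ofReal_mul (by positivity), ENNReal.ofReal_inv_of_pos h0,
    ENNReal.ofReal_natCast, ENNReal.ofReal_sum_of_nonneg fun a _ => hf a, Finset.mul_sum]
  exact Finset.sum_congr rfl fun a ha => by rw [PMF.uniformOfFinset_apply_of_mem hs ha]

open Classical in
theorem toOuterMeasure_eq_expectation (p : PMF α) (s : Set α) :
    p.toOuterMeasure s = expectation p fun a => ENNReal.ofReal (if a ∈ s then 1 else 0) := by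
  rw [PMF.toOuterMeasure_apply]
  exact tsum_congr fun a => by by_cases h : a ∈ s <;> simp [h]

end Expectation

/-! ### The means of the two sample values -/

section Samples

open Finset

variable {V : Type u} [Fintype V] (G : SimpleGraph V) [DecidableRel G.Adj]

theorem degreeOfName_apply (name : V ↪ ℕ) (v : V) : degreeOfName G name (name v) = G.degree v := by
  have h : ∃ w, name w = name v := ⟨v, rfl⟩
  rw [degreeOfName, dif_pos h, name.injective h.choose_spec]

theorem sampleValue_fst_of_mem [DecidableEq V] (name : V ↪ ℕ) {e : Sym2 V}
    (he : e ∈ G.edgeFinset) (v : V) :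
    (sampleValue G name (v, e)).1 = (∑ w, if w ∈ e then (G.degree w : ℝ)⁻¹ else 0) / 2 := by
  induction e with | _ a b
  have hab : a ≠ b := by
    rw [SimpleGraph.mem_edgeFinset, SimpleGraph.mem_edgeSet] at he
    exact he.ne
  have hsum : (∑ w, if w ∈ s(a, b) then (G.degree w : ℝ)⁻¹ else 0) =
      (G.degree a : ℝ)⁻¹ + (G.degree b : ℝ)⁻¹ := by
    rw [← Finset.sum_filter, ← Finset.sum_pair (f := fun w => (G.degree w : ℝ)⁻¹) hab]
    congr 1
    ext w
    simp
  rw [hsum]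
  simp only [sampleValue, Sym2.map_mk, Sym2.inf_mk, Sym2.sup_mk]
  rcases le_total (name a) (name b) with h | h
  · simp [h, degreeOfName_apply]
  · simp [h, degreeOfName_apply, add_comm]

variable [Nonempty V] (hE : G.edgeFinset.Nonempty)

/-- The mean over a random vertex and a random edge. -/
noncomputable def sampleMean : Mean (V × Sym2 V) where
  toLinear :=
    { toFun f := 𝔼 e ∈ G.edgeFinset, 𝔼 v, f (v, e)
      map_add' f g := by simp only [Pi.add_apply, expect_add_distrib]
      map_smul' c f := by
        simp only [Pi.smul_apply, smul_eq_mul, ← mul_expect, RingHom.id_apply] }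
  nonneg f hf := expect_nonneg fun e _ => expect_nonneg fun v _ => hf _
  const_one := by
    change (𝔼 e ∈ G.edgeFinset, 𝔼 v : V, (1 : ℝ)) = 1
    rw [Fintype.expect_const, expect_const hE]

theorem sampleMean_apply (f : V × Sym2 V → ℝ) :
    sampleMean G hE f = 𝔼 e ∈ G.edgeFinset, 𝔼 v, f (v, e) := rfl

theorem expectation_sample {f : V × Sym2 V → ℝ} (hf : ∀ ω, 0 ≤ f ω) :
    expectation (sample G hE) (fun ω => ENNReal.ofReal (f ω)) =
      ENNReal.ofReal (sampleMean G hE f) := by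
  rw [sampleMean_apply, ← expectation_uniformOfFinset _ hE
    fun e => expect_nonneg fun v _ => hf _]
  simp only [sample, expectation_bind, expectation_map]
  congr 1
  funext e
  exact expectation_uniformOfFinset univ univ_nonempty fun v => hf (v, e)

theorem expectation_samples (T : ℕ) {f : List (V × Sym2 V) → ℝ} (hf : ∀ L, 0 ≤ f L) :
    expectation (samples G hE T) (fun L => ENNReal.ofReal (f L)) =
      ENNReal.ofReal ((sampleMean G hE).iter T f) := by
  induction T generalizing f with
  | zero => exact expectation_pure _ _
  | succ T ih =>
    rw [samples, expectation_bind, Mean.iter_succ,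
      ← ih fun L => (sampleMean G hE).nonneg _ fun ω => hf (ω :: L)]
    congr 1
    funext L
    rw [expectation_map, expectation_sample G hE fun ω => hf (ω :: L)]

variable (name : V ↪ ℕ)

theorem sampleMean_snd :
    sampleMean G hE (fun ω => (sampleValue G name ω).2) =
      (numNonIsolated G : ℝ) / Fintype.card V := by
  simp only [sampleMean_apply, sampleValue, degreeOfName_apply]
  refine (expect_const hE (𝔼 v : V, if G.degree v = 0 then (0 : ℝ) else 1)).trans ?_
  rw [Fintype.expect_eq_sum_div_card, numNonIsolated, Finset.card_filter]
  push_cast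
  simp only [ite_not]

/-- Double counting: a non-isolated vertex receives its reciprocal degree from each incident edge,
hence `1` in total. -/
theorem sampleMean_fst [DecidableEq V] :
    sampleMean G hE (fun ω => (sampleValue G name ω).1) =
      (numNonIsolated G : ℝ) / (2 * #G.edgeFinset) := by
  have key : (∑ e ∈ G.edgeFinset, ∑ w, if w ∈ e then (G.degree w : ℝ)⁻¹ else 0) =
      numNonIsolated G := by
    rw [Finset.sum_comm, numNonIsolated, Finset.card_filter]
    push_cast
    refine Finset.sum_congr rfl fun w _ => ?_
    rw [← Finset.sum_filter, Finset.sum_const, ← G.incidenceFinset_eq_filter,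
      G.card_incidenceFinset_eq_degree, nsmul_eq_mul]
    split_ifs with h
    · exact mul_inv_cancel₀ (by exact_mod_cast h)
    · simp [not_not.1 h]
  rw [sampleMean_apply, Finset.expect_congr rfl fun e he =>
    (Finset.expect_congr rfl fun v _ => sampleValue_fst_of_mem G name he v)]
  simp only [Fintype.expect_const]
  rw [expect_eq_sum_div_card, ← Finset.sum_div, key, div_div]

end Samples
-- Numerical estimates
theorem div_mem_approximations {ε K a b x y : ℝ} (hε0 : 0 < ε) (hε1 : ε < 1) (hK : 0 < K)
    (hx : 0 < x) (hb0 : 0 ≤ b)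
    (ha1 : (1 - ε / 8) * K ≤ a * x) (ha2 : a * x ≤ (1 + 2 * (ε / 8)) * K)
    (hb1 : (1 - ε / 8) * K ≤ b * y) (hb2 : b * y ≤ (1 + 2 * (ε / 8)) * K) :
    a / b ∈ approximations ε (y / x) := by
  have hεK := mul_pos hε0 hK
  have hεεK : ε * (ε * K) < ε * K := by nlinarith
  have hb : 0 < b := by
    refine hb0.lt_of_ne fun h => ?_
    rw [← h] at hb1
    nlinarith
  constructor
  · rw [← mul_div_assoc, div_le_div_iff₀ hx hb]
    nlinarith [mul_le_mul_of_nonneg_left hb2 (sub_nonneg.2 hε1.le)]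
  · rw [← mul_div_assoc, div_le_div_iff₀ hb hx]
    nlinarith [mul_le_mul_of_nonneg_left hb1 (by linarith : 0 ≤ 1 + ε)]

/-- Since `e < 3`, one has `e^e < 27`, so `logLog x ≥ 1` beyond `27`; up to there the additive
constant suffices. -/
theorem le_logLog_add (x : ℝ) : x ≤ x * logLog x + 27 := by
  rcases le_or_gt x 27 with hx | hx
  · have : 0 ≤ logLog x := Real.log_nonneg (le_max_left _ _)
    rcases le_total 0 x with h | h
    · nlinarith [mul_nonneg h this]
    · have h1 : logLog x = 0 := by simp [logLog, max_eq_left (h.trans zero_le_one)]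
      rw [h1]; linarith
  · have he : Real.exp 1 < 3 := Real.exp_one_lt_d9.trans (by norm_num)
    have h1 : Real.exp 1 ≤ Real.log x := by
      refine he.le.trans ((Real.le_log_iff_exp_le (by linarith)).2 ?_)
      have : Real.exp 3 = Real.exp 1 ^ 3 := by rw [← Real.exp_nat_mul]; norm_num
      rw [this]
      calc Real.exp 1 ^ 3 ≤ 3 ^ 3 := by gcongr
        _ ≤ x := by linarith
    have h2 : 1 ≤ logLog x := by
      rw [logLog, max_eq_right (by linarith : 1 ≤ x)]
      have := Real.add_one_le_exp 1
      rw [max_eq_right (by linarith), Real.le_log_iff_exp_le (by linarith)]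
      exact h1
    nlinarith

/-! ### Query complexity and success probability -/

section Analysis

open Finset

variable {V : Type u} [Fintype V] (G : SimpleGraph V) [DecidableRel G.Adj]

theorem numNonIsolated_pos (hE : G.edgeFinset.Nonempty) : 0 < numNonIsolated G := by
  obtain ⟨e, he⟩ := hE
  induction e with | _ a b
  rw [SimpleGraph.mem_edgeFinset, SimpleGraph.mem_edgeSet] at he
  refine Finset.card_pos.2 ⟨a, ?_⟩
  have : 0 < G.degree a := (G.degree_pos_iff_exists_adj a).2 ⟨b, he⟩
  simpa using this.ne'

variable [Nonempty V] (name : V ↪ ℕ) (hE : G.edgeFinset.Nonempty)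

theorem length_le_of_mem_support_step (A : Algorithm) {s s' : State}
    (hs : s' ∈ (step G name hE A s).support) : s.1.length ≤ s'.1.length := by
  obtain ⟨h, _ | r⟩ := s
  · simp only [step, PMF.mem_support_bind_iff] at hs
    obtain ⟨q | r, -, hs⟩ := hs
    · simp only [PMF.mem_support_map_iff] at hs
      obtain ⟨e, -, rfl⟩ := hs
      simp
    · simp only [PMF.support_pure, Set.mem_singleton_iff] at hs
      simp [hs]
  · simp only [step, PMF.support_pure, Set.mem_singleton_iff] at hs
    simp [hs]

/-- Allows the supremum over all times to be bounded at multiples of `5`, where `run_eq` applies. -/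
theorem expectation_length_monotone (A : Algorithm) :
    Monotone fun t => expectation (run G name hE A t) fun s => (s.1.length : ℝ≥0∞) := by
  refine monotone_nat_of_le_succ fun t => ?_
  rw [run, expectation_bind]
  refine expectation_mono _ fun s _ => ?_
  rw [← expectation_const (step G name hE A s) s.1.length]
  exact expectation_mono _ fun s' hs => by
    exact_mod_cast length_le_of_mem_support_step G name hE A hs

theorem sampleMean_snd_pos : 0 < sampleMean G hE fun ω => (sampleValue G name ω).2 := by
  rw [sampleMean_snd]
  have := numNonIsolated_pos G hE
  positivity

variable [DecidableEq V]

theorem sampleMean_fst_pos : 0 < sampleMean G hE fun ω => (sampleValue G name ω).1 := by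
  rw [sampleMean_fst]
  have := numNonIsolated_pos G hE
  have := hE.card_pos
  positivity

theorem expectedQueries_estimator_le {K : ℝ} (hK : 0 ≤ K) :
    expectedQueries G name hE (estimator K) ≤
      ENNReal.ofReal (5 * (K + 1) *
        (2 * #G.edgeFinset / numNonIsolated G + Fintype.card V / numNonIsolated G)) := by
  refine iSup_le fun t => ?_
  change expectation _ _ ≤ _
  refine (expectation_length_monotone G name hE _ (by omega : t ≤ 5 * t)).trans ?_
  simp only [run_eq, expectation_map]
  have hlen : ∀ L, ((simulate G name K L).1.length : ℝ≥0∞) =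
      ENNReal.ofReal ((simulate G name K L).1.length : ℝ) := fun L => by simp
  simp only [hlen]
  rw [expectation_samples G hE t fun L => Nat.cast_nonneg _]
  refine ENNReal.ofReal_le_ofReal ?_
  set M := sampleMean G hE
  have h1 := M.iter_hitting_mul_le (sampleValue_fst_nonneg G name) (sampleValue_fst_le_one G name)
    hK t
  have h2 := M.iter_hitting_mul_le (sampleValue_snd_nonneg G name) (sampleValue_snd_le_one G name)
    hK t
  rw [← le_div_iff₀ (sampleMean_fst_pos G name hE)] at h1
  rw [← le_div_iff₀ (sampleMean_snd_pos G name hE)] at h2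
  rw [sampleMean_fst, div_div_eq_mul_div, mul_div_assoc] at h1
  rw [sampleMean_snd, div_div_eq_mul_div, mul_div_assoc] at h2
  refine ((M.iter t).mono fun L =>
    (Nat.cast_le (α := ℝ)).2 (length_simulate_le G name K L)).trans ?_
  simp only [Nat.cast_mul, Nat.cast_add, Mean.map_const_mul, Mean.map_add]
  push_cast
  linarith

theorem outputProb_estimator_ge {ε K : ℝ} (hε0 : 0 < ε) (hε1 : ε < 1)
    (hK : 24 ≤ (ε / 8) ^ 2 * K) :
    2 / 3 ≤ outputProb G name hE (estimator K) (approximations ε (avgDegree G)) := by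
  classical
  have hK0 : 0 < K := pos_of_mul_pos_right (by linarith : 0 < (ε / 8) ^ 2 * K) (sq_nonneg _)
  set M := sampleMean G hE with hM
  have hx := sampleMean_fst_pos G name hE
  have hy := sampleMean_snd_pos G name hE
  have hd : avgDegree G = M (fun ω => (sampleValue G name ω).2) /
      M (fun ω => (sampleValue G name ω).1) := by
    have h1 := numNonIsolated_pos G hE
    have h2 := hE.card_pos
    rw [hM, sampleMean_fst, sampleMean_snd, avgDegree]
    field_simp
  set X := fun ω => (sampleValue G name ω).1
  set Y := fun ω => (sampleValue G name ω).2
  set T := max ⌈(1 + ε / 8) * K / M X⌉₊ ⌈(1 + ε / 8) * K / M Y⌉₊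
  have b1 := M.iter_not_typical_le (X := X) (sampleValue_fst_nonneg G name)
    (sampleValue_fst_le_one G name) hx (by positivity) (by linarith) hK (le_max_left _ _ : _ ≤ T)
  have b2 := M.iter_not_typical_le (X := Y) (sampleValue_snd_nonneg G name)
    (sampleValue_snd_le_one G name) hy (by positivity) (by linarith) hK (le_max_right _ _ : _ ≤ T)
  -- After `T` rounds' worth of samples both sums have typically reached `K`; one more round's time
  -- lets the estimator emit its output.
  refine le_trans ?_ (le_iSup _ (5 * (T + 1)))
  rw [toOuterMeasure_eq_expectation, run_eq, expectation_map,
    expectation_samples G hE (T + 1) fun L => by positivity]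
  have h23 : (2 / 3 : ℝ≥0∞) = ENNReal.ofReal (2 / 3) := by
    rw [ENNReal.ofReal_div_of_pos (by norm_num)]; norm_num
  rw [h23]
  refine ENNReal.ofReal_le_ofReal ?_
  set B : List (V × Sym2 V) → ℝ := fun L =>
    1 - ((if ¬ Mean.Typical X (M X) (ε / 8) K L then 1 else 0) +
      if ¬ Mean.Typical Y (M Y) (ε / 8) K L then 1 else 0) with hB
  have hBT : 2 / 3 ≤ M.iter T B := by
    rw [hB, Mean.map_sub, Mean.map_const, Mean.map_add]
    linarith
  rw [← M.iter_drop T 1 B] at hBT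
  refine hBT.trans (M.iter_mono_of_length _ fun L hL => ?_)
  obtain _ | ⟨ω, L⟩ := L
  · simp at hL
  simp only [List.drop_succ_cons, List.drop_zero, hB]
  by_cases h1 : Mean.Typical X (M X) (ε / 8) K L
  · by_cases h2 : Mean.Typical Y (M Y) (ε / 8) K L
    · have hf : Finished K (L.map (sampleValue G name)) := by
        refine ⟨?_, ?_⟩
        · rw [List.map_map]; exact h1.1
        · rw [List.map_map]; exact h2.1
      have hout := simulate_cons_of_finished G name ω hf
      have hmem : simulate G name K (ω :: L) ∈
          {s : State | ∃ r ∈ approximations ε (avgDegree G), s.2 = some r} := by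
        refine ⟨_, ?_, hout⟩
        rw [hd, estimate, List.map_map, List.map_map]
        exact div_mem_approximations hε0 hε1 hK0 hx (Nat.cast_nonneg _) h1.2.1 h1.2.2
          h2.2.1 h2.2.2
      rw [if_pos hmem]
      simp [h1, h2]
    · simp only [h1, h2, not_true, not_false_iff, if_true, if_false]
      split_ifs <;> norm_num
  · simp only [h1, not_false_iff, if_true]
    split_ifs <;> norm_num

end Analysis
end EdgeCount

theorem mainTheorem10 :
    ∃ C : ℝ, 0 < C ∧ ∃ A : ℝ → EdgeCount.Algorithm,
      ∀ ε : ℝ, 0 < ε → ε < 1 →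
      ∀ (V : Type u) [Fintype V] [DecidableEq V] [Nonempty V]
        (G : SimpleGraph V) [DecidableRel G.Adj] (name : V ↪ ℕ) (hE : G.edgeFinset.Nonempty),
        2 / 3 ≤ EdgeCount.outputProb G name hE (A ε)
            (EdgeCount.approximations ε (EdgeCount.avgDegree G)) ∧
        EdgeCount.expectedQueries G name hE (A ε) ≤
          ENNReal.ofReal (C *
            ((G.edgeFinset.card : ℝ) * EdgeCount.logLog (EdgeCount.avgDegree G) /
                ((EdgeCount.numNonIsolated G : ℝ) * ε ^ 2) +
              (Fintype.card V : ℝ) / ((EdgeCount.numNonIsolated G : ℝ) * ε ^ 2))) := by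
  -- `1536 = 24 · 8²` gives `(ε/8)² K = 24`. In `C`, `5` counts queries per round, `1537` absorbs `K
  -- + 1` as `ε < 1`, and `28 = 27 + 1` comes from `le_logLog_add` and the term `n`.
  refine ⟨5 * 1537 * 28, by norm_num, fun ε => EdgeCount.estimator (1536 / ε ^ 2), ?_⟩
  intro ε hε0 hε1 V _ _ _ G _ name hE
  refine ⟨EdgeCount.outputProb_estimator_ge G name hE hε0 hε1 (by field_simp; norm_num), ?_⟩
  refine (EdgeCount.expectedQueries_estimator_le G name hE (by positivity)).trans
    (ENNReal.ofReal_le_ofReal ?_)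
  have hn' : (0 : ℝ) < EdgeCount.numNonIsolated G := by
    exact_mod_cast EdgeCount.numNonIsolated_pos G hE
  have hn : (0 : ℝ) < Fintype.card V := by exact_mod_cast Fintype.card_pos
  have hm : (0 : ℝ) < G.edgeFinset.card := by exact_mod_cast hE.card_pos
  have hl : 0 ≤ EdgeCount.logLog (EdgeCount.avgDegree G) := Real.log_nonneg (le_max_left _ _)
  have hmain : 2 * (G.edgeFinset.card : ℝ) ≤
      2 * G.edgeFinset.card * EdgeCount.logLog (EdgeCount.avgDegree G) + 27 * Fintype.card V := by
    have h := mul_le_mul_of_nonneg_right (EdgeCount.le_logLog_add (EdgeCount.avgDegree G)) hn.le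
    have hd : EdgeCount.avgDegree G * Fintype.card V = 2 * G.edgeFinset.card :=
      div_mul_cancel₀ _ hn.ne'
    rw [add_mul, mul_right_comm, hd] at h
    exact h
  generalize EdgeCount.logLog (EdgeCount.avgDegree G) = l at *
  have hK : 1536 / ε ^ 2 + 1 ≤ 1537 / ε ^ 2 := by
    rw [div_add_one (by positivity)]
    gcongr
    nlinarith
  calc _ ≤ 5 * (1537 / ε ^ 2) * (2 * (G.edgeFinset.card : ℝ) / EdgeCount.numNonIsolated G +
        Fintype.card V / EdgeCount.numNonIsolated G) := by gcongr
    _ = 5 * 1537 * (2 * (G.edgeFinset.card : ℝ) + Fintype.card V) /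
        (EdgeCount.numNonIsolated G * ε ^ 2) := by field_simp
    _ ≤ 5 * 1537 * (28 * (G.edgeFinset.card * l + Fintype.card V)) /
        (EdgeCount.numNonIsolated G * ε ^ 2) := by
      gcongr
      nlinarith [mul_nonneg hm.le hl]
    _ = _ := by rw [← add_div]; ring
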